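/- For $n\ge 1$ and $\theta\in\mathbb{R}^n$ let $P_\theta$ (with expectation $E_\theta$) be the law of $X=(X_1,\dots,X_n)$, $X_i=\theta_i+\varepsilon_i$, with $\varepsilon_1,\dots,\varepsilon_n$ i.i.d. $\mathcal N(0,1)$. A multiple testing procedure is a measurable map $\varphi=(\varphi_i)_{1\le i\le n}:\mathbb{R}^n\to\{0,1\}^n$; when asymptotics in $n$ are considered, it is a sequence of such maps, one for each $n$. Its combined risk at $\theta$ is \[ \mathfrak R(\theta,\varphi)=\mathrm{FDR}(\theta,\varphi)+\mathrm{FNR}(\theta,\varphi) =E_\theta\left[\frac{\sum_{i=1}^n \mathbf 1\{\theta_i=0\}\varphi_i(X)}{1\vee\sum_{i=1}^n\varphi_i(X)}\right] +E_\theta\left[\frac{\sum_{i=1}^n \mathbf 1\{\theta_i\ne0\}(1-\varphi_i(X))}{1\vee\sum_{i=1}^n\mathbf 1\{\theta_i\neq 0\}}\right]. \] Let $(s_n)$ be integers with $0\le s_n\le n$, $s_n\to\infty$ and $n/s_n\to\infty$ as $n\to\infty$. For $b\in\mathbb{R}$ let $\Theta_b$ be the set of all $\theta\in\mathbb{R}^n$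 with exactly $s_n$ nonzero coordinates, each of which satisfies $|\theta_i|\ge \sqrt{2\log(n/s_n)}+b$. (i) If $b=b_n\to+\infty$, then there exists a multiple testing procedure $\varphi$ such that $\sup_{\theta\in\Theta_{b_n}}\mathfrak R(\theta,\varphi)\to0$ as $n\to\infty$ (asymptotic conservative testing is possible). (ii) In contrast, for every fixed $b\in\mathbb{R}$, the limit $\lim_{n\to\infty}\inf_\varphi\sup_{\theta\in\Theta_b}\mathfrak R(\theta,\varphi)$, where the infimum is over all multiple testing procedures, exists and is strictly positive; consequently no multiple testing procedure $\varphi$ satisfies $\sup_{\theta\in\Theta_b}\mathfrak R(\theta,\varphi)\to0$ (asymptotic conservative testing is impossible). -/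

import Mathlib

open Filter Topology MeasureTheory ProbabilityTheory

noncomputable section

namespace SparseSeq

/-- The law `P_θ` of `X = θ + ε` on `ℝⁿ`, where `ε₁, …, εₙ` are i.i.d. `N(0,1)`. -/
def law {n : ℕ} (θ : Fin n → ℝ) : Measure (Fin n → ℝ) :=
  Measure.pi fun i => gaussianReal (θ i) 1

/-- A multiple testing procedure: a measurable map `φ : ℝⁿ → {0,1}ⁿ`,
where `φ x i = true` means that the null hypothesis `θ i = 0` is rejected. -/
structure Procedure (n : ℕ) where
  toFun : (Fin n → ℝ) → Fin n → Bool
  measurable_toFun : Measurable toFun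

instance (n : ℕ) : CoeFun (Procedure n) fun _ => (Fin n → ℝ) → Fin n → Bool :=
  ⟨Procedure.toFun⟩

/-- False discovery proportion at the observation `x`. -/
def FDP {n : ℕ} (θ : Fin n → ℝ) (φ : Procedure n) (x : Fin n → ℝ) : ℝ :=
  ((Finset.univ.filter fun i => θ i = 0 ∧ φ x i = true).card : ℝ) /
    max 1 ((Finset.univ.filter fun i => φ x i = true).card : ℝ)

/-- False negative proportion at the observation `x`. -/
def FNP {n : ℕ} (θ : Fin n → ℝ) (φ : Procedure n) (x : Fin n → ℝ) : ℝ :=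
  ((Finset.univ.filter fun i => θ i ≠ 0 ∧ φ x i = false).card : ℝ) /
    max 1 ((Finset.univ.filter fun i => θ i ≠ 0).card : ℝ)

/-- False discovery rate. -/
def FDR {n : ℕ} (θ : Fin n → ℝ) (φ : Procedure n) : ℝ := ∫ x, FDP θ φ x ∂(law θ)

/-- False negative rate. -/
def FNR {n : ℕ} (θ : Fin n → ℝ) (φ : Procedure n) : ℝ := ∫ x, FNP θ φ x ∂(law θ)

/-- Combined multiple testing risk. -/
def risk {n : ℕ} (θ : Fin n → ℝ) (φ : Procedure n) : ℝ := FDR θ φ + FNR θ φ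

/-- The class `Θ(a, s)` of vectors of `ℝⁿ` with exactly `s` nonzero coordinates,
all of them at least `a` in absolute value. -/
def betaMin (n : ℕ) (a : ℝ) (s : ℕ) : Set (Fin n → ℝ) :=
  {θ | (Finset.univ.filter fun i => θ i ≠ 0).card = s ∧ ∀ i, θ i ≠ 0 → a ≤ |θ i|}

/-- The class `Θ_b = Θ(√(2 log (n / s)) + b, s)`. -/
def classB (n s : ℕ) (b : ℝ) : Set (Fin n → ℝ) :=
  betaMin n (Real.sqrt (2 * Real.log ((n : ℝ) / (s : ℝ))) + b) s

/-- Worst-case combined risk of `φ` over `T`. -/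
def worstRisk {n : ℕ} (T : Set (Fin n → ℝ)) (φ : Procedure n) : ℝ := ⨆ θ : T, risk θ.1 φ

/-- Minimax combined risk over `T`, the infimum being over all multiple testing procedures. -/
def minimaxRisk {n : ℕ} (T : Set (Fin n → ℝ)) : ℝ := ⨅ φ : Procedure n, worstRisk T φ

end SparseSeq

end

namespace SparseSeq

/-! ### Gaussian facts -/

/-! Write t = √(2 log(n/s)) and let Φ be the standard normal cdf. The minimax risk over `classB n s
b` tends to Φ(-b), which is positive for fixed b and vanishes as b → ∞; both claims come from this
and from the bounds that prove it.

Upper bound: reject when |x i| ≥ t. A signal of size at least t + b is missed with probability at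
most Φ(-b). Since exp(-t²/2) = s/n, the Gaussian tail bound leaves at most 2s/t = o(s) expected
false rejections, while by Chebyshev the true rejections make up a fixed fraction of s with high
probability. Hence the FDR vanishes (`FDR_threshold_le`) and the FNR stays below Φ(-b).

Lower bound: average over all supports of size s carrying the value a = t + b. More than K s
rejections force an FDP of at least 1 - 1/K, so rejections may be capped at K s and only missed
signals counted (`le_FDP_add_FNP`). Deleting i from the support changes one coordinate, and
Neyman–Pearson bounds the probability of detecting i by 1 - Φ(u) plus exp(au + a²/2) times the
probability of rejecting i as a null. Summed over supports and points, these last terms count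
rejections outside supports of size s - 1 (`sum_powersetCard_succ_erase`); by the cap they are
negligible once u < -b. Finally u → -b and K → ∞. -/

lemma continuous_cdf_gaussianReal : Continuous (cdf (gaussianReal 0 1)) := by
  have : NullSingletonClass (gaussianReal 0 1) := nullSingletonClass_gaussianReal one_ne_zero
  refine continuous_iff_continuousAt.2 fun x => ?_
  rw [(monotone_cdf _).continuousAt_iff_leftLim_eq_rightLim, StieltjesFunction.rightLim_eq]
  -- The jump of the cdf at x is the mass of {x}, which is zero.
  have h := (cdf (gaussianReal 0 1)).measure_singleton x
  rw [measure_cdf, measure_singleton, eq_comm, ENNReal.ofReal_eq_zero] at h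
  exact le_antisymm ((monotone_cdf _).leftLim_le le_rfl) (by linarith)

lemma gaussianReal_real_pos {u : Set ℝ} (hu : IsOpen u) (hne : u.Nonempty) :
    0 < (gaussianReal 0 1).real u := by
  rw [measureReal_def, ENNReal.toReal_pos_iff]
  refine ⟨pos_iff_ne_zero.2 fun h => ?_, measure_lt_top _ _⟩
  exact hu.measure_ne_zero volume hne (gaussianReal_absolutelyContinuous' 0 one_ne_zero h)

lemma cdf_gaussianReal_pos (x : ℝ) : 0 < cdf (gaussianReal 0 1) x := by
  rw [cdf_eq_real]
  exact (gaussianReal_real_pos isOpen_Iio Set.nonempty_Iio).trans_le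
    (measureReal_mono Set.Iio_subset_Iic_self)

lemma gaussianReal_real_Ioi (x : ℝ) :
    (gaussianReal 0 1).real (Set.Ioi x) = 1 - cdf (gaussianReal 0 1) x := by
  rw [cdf_eq_real, ← Set.compl_Iic, probReal_compl_eq_one_sub measurableSet_Iic]

lemma cdf_gaussianReal_lt_one (x : ℝ) : cdf (gaussianReal 0 1) x < 1 := by
  have := gaussianReal_real_pos (isOpen_Ioi (a := x)) Set.nonempty_Ioi
  rw [gaussianReal_real_Ioi] at this
  linarith

lemma gaussianReal_real_eq_preimage (m : ℝ) {A : Set ℝ} (hA : MeasurableSet A) :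
    (gaussianReal m 1).real A = (gaussianReal 0 1).real ((fun x => x + m) ⁻¹' A) := by
  have h := gaussianReal_map_add_const (μ := 0) (v := 1) m
  rw [zero_add] at h
  rw [← h, map_measureReal_apply (by fun_prop) hA]

lemma gaussianReal_real_neg {A : Set ℝ} (hA : MeasurableSet A) :
    (gaussianReal 0 1).real ((fun x => -x) ⁻¹' A) = (gaussianReal 0 1).real A := by
  have h := gaussianReal_map_neg (μ := 0) (v := 1)
  rw [neg_zero] at h
  conv_rhs => rw [← h, map_measureReal_apply (by fun_prop) hA]

lemma gaussianReal_real_Ici_neg (x : ℝ) :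
    (gaussianReal 0 1).real (Set.Ici x) = cdf (gaussianReal 0 1) (-x) := by
  rw [cdf_eq_real, ← gaussianReal_real_neg measurableSet_Iic]
  congr 1
  ext y
  simp

/-- A Gaussian with mean at distance at least `t + β` from `0` rarely falls in `(-t, t)`. -/
lemma gaussianReal_real_abs_lt_le {t β m : ℝ} (h : t + β ≤ |m|) :
    (gaussianReal m 1).real {x | |x| < t} ≤ cdf (gaussianReal 0 1) (-β) := by
  rw [gaussianReal_real_eq_preimage m (measurableSet_lt (by fun_prop) measurable_const)]
  rcases le_total 0 m with hm | hm
  · rw [abs_of_nonneg hm] at h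
    rw [cdf_eq_real]
    refine measureReal_mono fun x hx => ?_
    have hx : |x + m| < t := hx
    have := (abs_lt.1 hx).2
    simp only [Set.mem_Iic]
    linarith
  · rw [abs_of_nonpos hm] at h
    rw [← gaussianReal_real_Ici_neg]
    refine measureReal_mono fun x hx => ?_
    have hx : |x + m| < t := hx
    have := (abs_lt.1 hx).1
    simp only [Set.mem_Ici]
    linarith

/-- Mills-type tail bound. -/
lemma gaussianReal_real_Ici_le {t : ℝ} (ht : 0 < t) :
    (gaussianReal 0 1).real (Set.Ici t) ≤ Real.exp (-t ^ 2 / 2) / t := by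
  have hint : IntegrableOn (fun x => Real.exp (t ^ 2 / 2) * Real.exp (-t * x)) (Set.Ioi t) :=
    (integrableOn_exp_mul_Ioi (by linarith) t).const_mul _
  have : NullSingletonClass (gaussianReal 0 1) := nullSingletonClass_gaussianReal one_ne_zero
  rw [measureReal_congr Ioi_ae_eq_Ici.symm, measureReal_def,
    gaussianReal_apply_eq_integral 0 one_ne_zero,
    ENNReal.toReal_ofReal (setIntegral_nonneg measurableSet_Ioi
      fun x _ => gaussianPDFReal_nonneg _ _ _)]
  calc ∫ x in Set.Ioi t, gaussianPDFReal 0 1 x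
      ≤ ∫ x in Set.Ioi t, Real.exp (t ^ 2 / 2) * Real.exp (-t * x) := by
        -- The normalising constant is at most 1, and (x - t)² ≥ 0 gives -x²/2 ≤ t²/2 - tx.
        refine setIntegral_mono (integrable_gaussianPDFReal 0 1).integrableOn hint fun x => ?_
        have h1 : (√(2 * Real.pi * 1))⁻¹ ≤ 1 := by
          refine inv_le_one_of_one_le₀ (Real.one_le_sqrt.2 ?_)
          linarith [Real.pi_gt_three]
        simp only [gaussianPDFReal, NNReal.coe_one, sub_zero]
        rw [← Real.exp_add]
        refine (mul_le_of_le_one_left (Real.exp_nonneg _) h1).trans (Real.exp_le_exp.2 ?_)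
        nlinarith [sq_nonneg (x - t)]
    _ = Real.exp (-t ^ 2 / 2) / t := by
        rw [integral_const_mul, integral_exp_mul_Ioi (by linarith), neg_div_neg_eq,
          ← mul_div_assoc, ← Real.exp_add]
        congr 2
        ring

lemma gaussianReal_real_le_abs_le {t : ℝ} (ht : 0 < t) :
    (gaussianReal 0 1).real {x | t ≤ |x|} ≤ 2 * (Real.exp (-t ^ 2 / 2) / t) := by
  have hs : {x : ℝ | t ≤ |x|} = Set.Ici t ∪ (fun x => -x) ⁻¹' Set.Ici t := by
    ext x
    simp only [Set.mem_ofPred_eq, le_abs, Set.mem_union, Set.mem_Ici, Set.mem_preimage]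
  rw [hs, two_mul]
  refine (measureReal_union_le _ _).trans ?_
  rw [gaussianReal_real_neg measurableSet_Ici]
  exact add_le_add (gaussianReal_real_Ici_le ht) (gaussianReal_real_Ici_le ht)

/-- Neyman–Pearson comparison of `N(a, 1)` with `N(0, 1)`. -/
lemma lintegral_gaussianReal_le {a : ℝ} (ha : 0 < a) (u : ℝ) {g : ℝ → ENNReal}
    (hg : Measurable g) (hg1 : ∀ x, g x ≤ 1) :
    ∫⁻ x, g x ∂(gaussianReal a 1) ≤ ENNReal.ofReal (1 - cdf (gaussianReal 0 1) u) +
      ENNReal.ofReal (Real.exp (a * u + a ^ 2 / 2)) * ∫⁻ x, g x ∂(gaussianReal 0 1) := by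
  have htail : gaussianReal a 1 (Set.Ioi (a + u)) =
      ENNReal.ofReal (1 - cdf (gaussianReal 0 1) u) := by
    rw [← ofReal_measureReal, gaussianReal_real_eq_preimage a measurableSet_Ioi,
      ← gaussianReal_real_Ioi]
    congr 2
    ext x
    simp only [Set.mem_preimage, Set.mem_Ioi]
    constructor <;> intro h <;> linarith
  -- Above a + u, bound g by 1. Below it, the likelihood ratio exp(ax - a²/2) is at most its value
  -- exp(au + a²/2) at the cut.
  rw [← lintegral_add_compl _ (measurableSet_Ioi (a := a + u)), ← htail]
  refine add_le_add ?_ ?_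
  · refine (lintegral_mono fun x => hg1 x).trans ?_
    simp
  · rw [gaussianReal_of_var_ne_zero _ one_ne_zero, gaussianReal_of_var_ne_zero _ one_ne_zero,
      restrict_withDensity measurableSet_Ioi.compl,
      lintegral_withDensity_eq_lintegral_mul _ (measurable_gaussianPDF _ _) hg,
      lintegral_withDensity_eq_lintegral_mul _ (measurable_gaussianPDF _ _) hg,
      ← lintegral_const_mul _ ((measurable_gaussianPDF _ _).mul hg)]
    refine (setLIntegral_mono (by fun_prop) fun x hx => ?_).trans (setLIntegral_le_lintegral _ _)
    simp only [Set.mem_compl_iff, Set.mem_Ioi, not_lt] at hx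
    simp only [Pi.mul_apply]
    rw [← mul_assoc]
    refine mul_le_mul_left ?_ _
    rw [gaussianPDF, gaussianPDF, ← ENNReal.ofReal_mul (Real.exp_nonneg _)]
    refine ENNReal.ofReal_le_ofReal ?_
    simp only [gaussianPDFReal]
    rw [mul_left_comm, ← Real.exp_add]
    refine mul_le_mul_of_nonneg_left (Real.exp_le_exp.2 ?_) (by positivity)
    simp only [NNReal.coe_one]
    nlinarith

end SparseSeq

namespace SparseSeq

/-! ### Elementary properties of the risk -/

variable {n : ℕ}

instance isProbabilityMeasure_law (θ : Fin n → ℝ) : IsProbabilityMeasure (law θ) := by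
  unfold law
  infer_instance

instance nonempty_procedure : Nonempty (Procedure n) :=
  ⟨⟨fun _ _ => false, measurable_const⟩⟩

lemma Procedure.measurable_comp (φ : Procedure n) (F : (Fin n → Bool) → ℝ) :
    Measurable fun x => F (φ x) :=
  (measurable_of_finite F).comp φ.measurable_toFun

lemma measurable_FDP (θ : Fin n → ℝ) (φ : Procedure n) : Measurable (FDP θ φ) :=
  φ.measurable_comp fun v => ((Finset.univ.filter fun i => θ i = 0 ∧ v i = true).card : ℝ) /
    max 1 ((Finset.univ.filter fun i => v i = true).card : ℝ)

lemma measurable_FNP (θ : Fin n → ℝ) (φ : Procedure n) : Measurable (FNP θ φ) :=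
  φ.measurable_comp fun v => ((Finset.univ.filter fun i => θ i ≠ 0 ∧ v i = false).card : ℝ) /
    max 1 ((Finset.univ.filter fun i => θ i ≠ 0).card : ℝ)

lemma FDP_nonneg (θ : Fin n → ℝ) (φ : Procedure n) (x : Fin n → ℝ) : 0 ≤ FDP θ φ x := by
  unfold FDP
  positivity

lemma FNP_nonneg (θ : Fin n → ℝ) (φ : Procedure n) (x : Fin n → ℝ) : 0 ≤ FNP θ φ x := by
  unfold FNP
  positivity

lemma FDP_le_one (θ : Fin n → ℝ) (φ : Procedure n) (x : Fin n → ℝ) : FDP θ φ x ≤ 1 := by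
  refine div_le_one_of_le₀ (le_max_of_le_right ?_) (by positivity)
  exact_mod_cast Finset.card_le_card (Finset.monotone_filter_right _ fun i _ (hi : _ ∧ _) => hi.2)

lemma FNP_le_one (θ : Fin n → ℝ) (φ : Procedure n) (x : Fin n → ℝ) : FNP θ φ x ≤ 1 := by
  refine div_le_one_of_le₀ (le_max_of_le_right ?_) (by positivity)
  exact_mod_cast Finset.card_le_card (Finset.monotone_filter_right _ fun i _ (hi : _ ∧ _) => hi.1)

lemma integrable_of_mem_Icc {Ω : Type*} [MeasurableSpace Ω] {μ : Measure Ω} [IsFiniteMeasure μ]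
    {f : Ω → ℝ} (hf : Measurable f) (h0 : ∀ x, 0 ≤ f x) (h1 : ∀ x, f x ≤ 1) : Integrable f μ :=
  Integrable.of_bound hf.aestronglyMeasurable 1 <| ae_of_all _ fun x => by
    rw [Real.norm_of_nonneg (h0 x)]
    exact h1 x

lemma integrable_FDP (θ : Fin n → ℝ) (φ : Procedure n) : Integrable (FDP θ φ) (law θ) :=
  integrable_of_mem_Icc (measurable_FDP θ φ) (FDP_nonneg θ φ) (FDP_le_one θ φ)

lemma integrable_FNP (θ : Fin n → ℝ) (φ : Procedure n) : Integrable (FNP θ φ) (law θ) :=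
  integrable_of_mem_Icc (measurable_FNP θ φ) (FNP_nonneg θ φ) (FNP_le_one θ φ)

lemma risk_eq_integral (θ : Fin n → ℝ) (φ : Procedure n) :
    risk θ φ = ∫ x, (FDP θ φ x + FNP θ φ x) ∂law θ :=
  (integral_add (integrable_FDP θ φ) (integrable_FNP θ φ)).symm

lemma risk_nonneg (θ : Fin n → ℝ) (φ : Procedure n) : 0 ≤ risk θ φ :=
  add_nonneg (integral_nonneg (FDP_nonneg θ φ)) (integral_nonneg (FNP_nonneg θ φ))

/-- Boundedness makes the real supremum in `worstRisk` genuine rather than the default value 0. -/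
lemma risk_le_two (θ : Fin n → ℝ) (φ : Procedure n) : risk θ φ ≤ 2 := by
  have h1 := integral_mono (integrable_FDP θ φ) (integrable_const 1) (FDP_le_one θ φ)
  have h2 := integral_mono (integrable_FNP θ φ) (integrable_const 1) (FNP_le_one θ φ)
  simp only [integral_const, probReal_univ, smul_eq_mul, mul_one] at h1 h2
  unfold risk FDR FNR
  linarith

lemma worstRisk_nonneg (T : Set (Fin n → ℝ)) (φ : Procedure n) : 0 ≤ worstRisk T φ :=
  Real.iSup_nonneg fun θ => risk_nonneg θ.1 φ

lemma risk_le_worstRisk {T : Set (Fin n → ℝ)} {θ : Fin n → ℝ} (hθ : θ ∈ T) (φ : Procedure n) :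
    risk θ φ ≤ worstRisk T φ :=
  le_ciSup (f := fun θ : T => risk θ.1 φ)
    ⟨2, Set.forall_mem_range.2 fun θ => risk_le_two θ.1 φ⟩ ⟨θ, hθ⟩

lemma minimaxRisk_le_worstRisk (T : Set (Fin n → ℝ)) (φ : Procedure n) :
    minimaxRisk T ≤ worstRisk T φ :=
  ciInf_le ⟨0, Set.forall_mem_range.2 fun φ => worstRisk_nonneg T φ⟩ φ

/-! ### Risk of the thresholding procedure -/

/-- The procedure which rejects the hypotheses with `t ≤ |x i|`. -/
noncomputable def threshold (n : ℕ) (t : ℝ) : Procedure n where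
  toFun x i := decide (t ≤ |x i|)
  measurable_toFun := by
    refine measurable_pi_lambda _ fun i => measurable_to_bool ?_
    have : (fun x : Fin n → ℝ => decide (t ≤ |x i|)) ⁻¹' {true} = {x | t ≤ |x i|} := by
      ext x
      simp
    rw [this]
    exact measurableSet_le measurable_const (by fun_prop)

lemma threshold_eq_true {t : ℝ} {x : Fin n → ℝ} {i : Fin n} :
    threshold n t x i = true ↔ t ≤ |x i| := by
  simp [threshold]

lemma threshold_eq_false {t : ℝ} {x : Fin n → ℝ} {i : Fin n} :
    threshold n t x i = false ↔ |x i| < t := by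
  simp [threshold]

/-- The indicator of `A`, switched off when `p` fails. -/
noncomputable def selected (p : Prop) (A : Set ℝ) (y : ℝ) : ℝ :=
  open Classical in if p ∧ y ∈ A then 1 else 0

lemma selected_nonneg (p : Prop) (A : Set ℝ) (y : ℝ) : 0 ≤ selected p A y := by
  unfold selected
  split_ifs <;> norm_num

lemma selected_le_one (p : Prop) (A : Set ℝ) (y : ℝ) : selected p A y ≤ 1 := by
  unfold selected
  split_ifs <;> norm_num

lemma selected_of_true {p : Prop} (hp : p) (A : Set ℝ) :
    selected p A = A.indicator fun _ => 1 := by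
  ext y
  unfold selected
  by_cases hy : y ∈ A
  · rw [if_pos ⟨hp, hy⟩, Set.indicator_of_mem hy]
  · rw [if_neg fun h => hy h.2, Set.indicator_of_notMem hy]

lemma selected_of_false {p : Prop} (hp : ¬p) (A : Set ℝ) : selected p A = fun _ => 0 := by
  ext y
  exact if_neg fun h => hp h.1

lemma measurable_selected (p : Prop) {A : Set ℝ} (hA : MeasurableSet A) :
    Measurable (selected p A) := by
  by_cases hp : p
  · rw [selected_of_true hp]
    exact measurable_const.indicator hA
  · rw [selected_of_false hp]
    exact measurable_const

lemma card_filter_eq_sum_selected (p : Fin n → Prop) (A : Set ℝ) (x : Fin n → ℝ)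
    [DecidablePred fun i => p i ∧ x i ∈ A] :
    ((Finset.univ.filter fun i => p i ∧ x i ∈ A).card : ℝ) = ∑ i, selected (p i) A (x i) := by
  rw [Finset.card_filter, Nat.cast_sum]
  refine Finset.sum_congr rfl fun i _ => ?_
  unfold selected
  split_ifs <;> simp

lemma integral_selected (p : Prop) [Decidable p] {A : Set ℝ} (hA : MeasurableSet A) (m : ℝ) :
    ∫ y, selected p A y ∂gaussianReal m 1 = if p then (gaussianReal m 1).real A else 0 := by
  split_ifs with hp
  · rw [selected_of_true hp, integral_indicator_const _ hA, smul_eq_mul, mul_one]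
  · rw [selected_of_false hp, integral_zero]

lemma integrable_sum_selected (θ : Fin n → ℝ) (p : Fin n → Prop) {A : Set ℝ}
    (hA : MeasurableSet A) :
    Integrable (fun x : Fin n → ℝ => ∑ i, selected (p i) A (x i)) (law θ) :=
  integrable_finsetSum _ fun i _ => integrable_of_mem_Icc
    ((measurable_selected (p i) hA).comp (measurable_pi_apply i))
    (fun _ => selected_nonneg _ _ _) fun _ => selected_le_one _ _ _

lemma integral_sum_selected (θ : Fin n → ℝ) (p : Fin n → Prop) [DecidablePred p] {A : Set ℝ}
    (hA : MeasurableSet A) :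
    ∫ x, ∑ i, selected (p i) A (x i) ∂law θ =
      ∑ i, if p i then (gaussianReal (θ i) 1).real A else 0 := by
  rw [integral_finsetSum]
  · refine Finset.sum_congr rfl fun i _ => ?_
    rw [← integral_selected (p i) hA]
    exact integral_comp_eval (μ := fun i => gaussianReal (θ i) 1)
      (measurable_selected (p i) hA).aestronglyMeasurable
  · exact fun i _ => integrable_of_mem_Icc
      ((measurable_selected (p i) hA).comp (measurable_pi_apply i))
      (fun _ => selected_nonneg _ _ _) fun _ => selected_le_one _ _ _

/-- The coordinates are independent, and a variable with values in [0, 1] has variance at most 1/4;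
indices where `p` fails contribute nothing. -/
lemma variance_sum_selected_le (θ : Fin n → ℝ) (p : Fin n → Prop) [DecidablePred p] {A : Set ℝ}
    (hA : MeasurableSet A) :
    Var[fun x => ∑ i, selected (p i) A (x i); law θ] ≤
      (Finset.univ.filter p).card / 4 := by
  have h := variance_sum_pi (μ := fun i => gaussianReal (θ i) 1)
    (X := fun i => selected (p i) A) fun i =>
      MemLp.of_bound (measurable_selected (p i) hA).aestronglyMeasurable 1 <| ae_of_all _ fun y => by
        rw [Real.norm_of_nonneg (selected_nonneg _ _ _)]
        exact selected_le_one _ _ _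
  have hfun : (∑ i, fun x : Fin n → ℝ => selected (p i) A (x i)) =
      fun x => ∑ i, selected (p i) A (x i) := by
    ext x
    simp
  rw [hfun] at h
  rw [law, h, Finset.card_filter, Nat.cast_sum, Finset.sum_div]
  refine Finset.sum_le_sum fun i _ => ?_
  by_cases hp : p i
  · refine (variance_le_sq_of_bounded (a := 0) (b := 1) (ae_of_all _ fun y =>
      ⟨selected_nonneg _ _ _, selected_le_one _ _ _⟩)
      (measurable_selected (p i) hA).aemeasurable).trans ?_
    simp only [hp, if_true]
    norm_num
  · rw [selected_of_false hp]
    simp only [if_neg hp, Nat.cast_zero, zero_div]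
    exact (variance_zero _).le

/-! ### Missed signals and false discoveries of the threshold -/

lemma FNR_threshold_le {s : ℕ} {θ : Fin n → ℝ} {t β : ℝ} (hs : 0 < s)
    (hθ : θ ∈ betaMin n (t + β) s) :
    FNR θ (threshold n t) ≤ cdf (gaussianReal 0 1) (-β) := by
  have hs1 : (1 : ℝ) ≤ s := by exact_mod_cast hs
  have hA : MeasurableSet {y : ℝ | |y| < t} := measurableSet_lt (by fun_prop) measurable_const
  have hpt : FNP θ (threshold n t) =
      fun x => (∑ i, selected (θ i ≠ 0) {y | |y| < t} (x i)) / s := by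
    ext x
    rw [FNP, hθ.1, max_eq_right hs1, ← card_filter_eq_sum_selected]
    simp only [threshold_eq_false, Set.mem_ofPred_eq]
  rw [FNR, hpt, integral_div, integral_sum_selected _ _ hA, div_le_iff₀ (by positivity),
    ← Finset.sum_filter]
  refine (Finset.sum_le_card_nsmul _ _ (cdf (gaussianReal 0 1) (-β)) fun i hi => ?_).trans ?_
  · exact gaussianReal_real_abs_lt_le (hθ.2 i (Finset.mem_filter.1 hi).2)
  · rw [hθ.1, nsmul_eq_mul, mul_comm]

/-- With large probability, thresholding detects a fixed proportion of the signals. -/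
lemma law_real_few_detections_le {s : ℕ} {θ : Fin n → ℝ} {t β q : ℝ} (hs : 0 < s)
    (hq : q = cdf (gaussianReal 0 1) (-β)) (hθ : θ ∈ betaMin n (t + β) s) :
    (law θ).real {x | ∑ i, selected (θ i ≠ 0) {y | t ≤ |y|} (x i) < (1 - q) / 2 * s} ≤
      1 / ((1 - q) ^ 2 * s) := by
  have hs0 : (0 : ℝ) < s := by exact_mod_cast hs
  have hq1 : 0 < 1 - q := by
    rw [hq]
    linarith [cdf_gaussianReal_lt_one (-β)]
  have hA : MeasurableSet {y : ℝ | t ≤ |y|} := measurableSet_le measurable_const (by fun_prop)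
  have hmean : (1 - q) * s ≤ ∫ x, ∑ i, selected (θ i ≠ 0) {y | t ≤ |y|} (x i) ∂law θ := by
    rw [integral_sum_selected _ _ hA, ← Finset.sum_filter]
    refine le_trans ?_ (Finset.card_nsmul_le_sum _ _ (1 - q) fun i hi => ?_)
    · rw [hθ.1, nsmul_eq_mul, mul_comm]
    · have h := gaussianReal_real_abs_lt_le (hθ.2 i (Finset.mem_filter.1 hi).2)
      have hc : {y : ℝ | t ≤ |y|} = {y | |y| < t}ᶜ := by
        ext y
        simp
      rw [hc, probReal_compl_eq_one_sub (measurableSet_lt (by fun_prop) measurable_const)]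
      linarith
  have hL2 : MemLp (fun x : Fin n → ℝ => ∑ i, selected (θ i ≠ 0) {y | t ≤ |y|} (x i)) 2
      (law θ) :=
    memLp_finsetSum _ fun i _ => MemLp.of_bound
      ((measurable_selected _ hA).comp (measurable_pi_apply i)).aestronglyMeasurable 1 <|
        ae_of_all _ fun x => by
          rw [Real.norm_of_nonneg (selected_nonneg _ _ _)]
          exact selected_le_one _ _ _
  -- The deviation is half the lower bound (1 - q)s on the mean, and the variance is at most s/4;
  -- their quotient is exactly 1/((1 - q)²s).
  have hcheb := meas_ge_le_variance_div_sq hL2 (c := (1 - q) / 2 * s) (by positivity)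
  have hvar := variance_sum_selected_le θ (fun i => θ i ≠ 0) hA
  rw [hθ.1] at hvar
  refine ENNReal.toReal_le_of_le_ofReal (by positivity) (le_trans (measure_mono ?_)
    (hcheb.trans (ENNReal.ofReal_le_ofReal ?_)))
  · intro x hx
    simp only [Set.mem_ofPred_eq] at hx ⊢
    rw [abs_sub_comm]
    refine le_trans ?_ (le_abs_self _)
    linarith
  · rw [div_le_div_iff₀ (by positivity) (by positivity)]
    have : 0 ≤ (1 - q) ^ 2 * s := by positivity
    nlinarith [mul_le_mul_of_nonneg_right hvar this]

lemma FDR_threshold_le {s : ℕ} {θ : Fin n → ℝ} {t β q : ℝ} (hs : 0 < s) (ht : 0 < t)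
    (hq : q = cdf (gaussianReal 0 1) (-β)) (hθ : θ ∈ betaMin n (t + β) s) :
    FDR θ (threshold n t) ≤
      n * (2 * (Real.exp (-t ^ 2 / 2) / t)) / ((1 - q) / 2 * s) + 1 / ((1 - q) ^ 2 * s) := by
  have hs0 : (0 : ℝ) < s := by exact_mod_cast hs
  have hq1 : 0 < 1 - q := by
    rw [hq]
    linarith [cdf_gaussianReal_lt_one (-β)]
  have hA : MeasurableSet {y : ℝ | t ≤ |y|} := measurableSet_le measurable_const (by fun_prop)
  set S : (Fin n → ℝ) → ℝ := fun x => ∑ i, selected (θ i ≠ 0) {y | t ≤ |y|} (x i) with hS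
  set V : (Fin n → ℝ) → ℝ := fun x => ∑ i, selected (θ i = 0) {y | t ≤ |y|} (x i) with hV
  set η : ℝ := (1 - q) / 2 * s with hη
  have hη0 : 0 < η := by positivity
  have hSm : Measurable S := Finset.measurable_sum _ fun i _ =>
    (measurable_selected _ hA).comp (measurable_pi_apply i)
  have hE : MeasurableSet {x | S x < η} := measurableSet_lt hSm measurable_const
  -- Either there are at least η true rejections, which bounds the denominator below, or the rare
  -- event occurs and the FDP is bounded by 1.
  have hpt : ∀ x, FDP θ (threshold n t) x ≤
      V x / η + {x | S x < η}.indicator (fun _ => (1 : ℝ)) x := by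
    intro x
    have hV0 : 0 ≤ V x := Finset.sum_nonneg fun i _ => selected_nonneg _ _ _
    by_cases hx : S x < η
    · rw [Set.indicator_of_mem (by exact hx)]
      have := FDP_le_one θ (threshold n t) x
      have : 0 ≤ V x / η := by positivity
      linarith
    · rw [Set.indicator_of_notMem (by exact hx), add_zero, FDP]
      have hVx : V x = ((Finset.univ.filter fun i =>
          θ i = 0 ∧ threshold n t x i = true).card : ℝ) := by
        rw [hV]
        simp only
        rw [← card_filter_eq_sum_selected]
        simp only [threshold_eq_true, Set.mem_ofPred_eq]
      rw [← hVx]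
      refine div_le_div_of_nonneg_left hV0 hη0 ((not_lt.1 hx).trans (le_max_of_le_right ?_))
      rw [hS]
      simp only
      rw [← card_filter_eq_sum_selected]
      simp only [threshold_eq_true, Set.mem_ofPred_eq]
      exact_mod_cast Finset.card_le_card (Finset.monotone_filter_right _ fun i _ (hi : _ ∧ _) => hi.2)
  have hVint : Integrable V (law θ) := integrable_sum_selected θ _ hA
  have hEint : Integrable ({x | S x < η}.indicator fun _ => (1 : ℝ)) (law θ) :=
    (integrable_const 1).indicator hE
  refine (integral_mono (integrable_FDP _ _) ((hVint.div_const η).add hEint) hpt).trans ?_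
  rw [integral_add' (hVint.div_const η) hEint, integral_div, integral_indicator_const _ hE,
    smul_eq_mul, mul_one]
  refine add_le_add (div_le_div_of_nonneg_right ?_ hη0.le) (law_real_few_detections_le hs hq hθ)
  rw [hV, integral_sum_selected _ _ hA]
  refine (Finset.sum_le_card_nsmul _ _ (2 * (Real.exp (-t ^ 2 / 2) / t)) fun i _ => ?_).trans ?_
  · split_ifs with h
    · rw [h]
      exact gaussianReal_real_le_abs_le ht
    · positivity
  · simp

lemma worstRisk_threshold_le {s : ℕ} {t β q : ℝ} (hs : 0 < s) (ht : 0 < t)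
    (hq : q = cdf (gaussianReal 0 1) (-β)) :
    worstRisk (betaMin n (t + β) s) (threshold n t) ≤
      n * (2 * (Real.exp (-t ^ 2 / 2) / t)) / ((1 - q) / 2 * s) + 1 / ((1 - q) ^ 2 * s) + q := by
  have hq0 : 0 ≤ q := hq ▸ cdf_nonneg _ _
  have hq1 : 0 < 1 - q := by
    rw [hq]
    linarith [cdf_gaussianReal_lt_one (-β)]
  -- The class may be empty, with supremum 0 by default; hence nonnegativity of the bound is also
  -- needed.
  refine Real.iSup_le (fun θ => add_le_add (FDR_threshold_le hs ht hq θ.2) ?_) (by positivity)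
  rw [hq]
  exact FNR_threshold_le hs θ.2

/-! ### Lower bound for the worst-case risk -/

lemma measurable_update_prod {ι : Type*} [DecidableEq ι] (i : ι) :
    Measurable fun p : (ι → ℝ) × ℝ => Function.update p.1 i p.2 := by
  refine measurable_pi_lambda _ fun j => ?_
  by_cases h : j = i
  · subst h
    simpa using measurable_snd
  · simp only [Function.update_of_ne h]
    fun_prop

/-- Independently resampling coordinate i replaces the i-th factor of the product. Two laws
differing in one mean thus become iterated integrals with a common outer law. -/
lemma pi_update_eq_map {ι : Type*} [Fintype ι] [DecidableEq ι] (μ : ι → Measure ℝ)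
    [∀ i, IsProbabilityMeasure (μ i)] (i : ι) (ν : Measure ℝ) [IsProbabilityMeasure ν]
    [∀ j, IsProbabilityMeasure (Function.update μ i ν j)] :
    ((Measure.pi μ).prod ν).map (fun p => Function.update p.1 i p.2) =
      Measure.pi (Function.update μ i ν) := by
  have hm := measurable_update_prod i
  refine (Measure.pi_eq fun s hs => ?_).symm
  rw [Measure.map_apply hm (MeasurableSet.univ_pi hs)]
  have hpre : (fun p : (ι → ℝ) × ℝ => Function.update p.1 i p.2) ⁻¹' Set.univ.pi s =
      (Set.univ.pi (Function.update s i Set.univ)) ×ˢ s i := by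
    ext ⟨x, y⟩
    simp only [Set.mem_preimage, Set.mem_univ_pi, Set.mem_prod]
    constructor
    · refine fun h => ⟨fun j => ?_, by simpa using h i⟩
      by_cases hj : j = i
      · subst hj
        simp
      · simpa [hj] using h j
    · rintro ⟨h, hy⟩ j
      by_cases hj : j = i
      · subst hj
        simpa using hy
      · simpa [hj] using h j
  rw [hpre, Measure.prod_prod, Measure.pi_pi, Fintype.prod_eq_mul_prod_compl i,
    Fintype.prod_eq_mul_prod_compl i]
  simp only [Function.update_self, measure_univ, one_mul]
  rw [mul_comm]
  congr 1
  refine Finset.prod_congr rfl fun j hj => ?_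
  have hj : j ≠ i := by simpa using hj
  simp [hj]

lemma lintegral_law_update (θ : Fin n → ℝ) (i : Fin n) (a : ℝ) {f : (Fin n → ℝ) → ENNReal}
    (hf : Measurable f) :
    ∫⁻ x, f x ∂law (Function.update θ i a) =
      ∫⁻ x, ∫⁻ y, f (Function.update x i y) ∂gaussianReal a 1 ∂law θ := by
  have hm := measurable_update_prod i
  have hup : (fun j => gaussianReal (Function.update θ i a j) 1) =
      Function.update (fun j => gaussianReal (θ j) 1) i (gaussianReal a 1) := by
    ext1 j
    by_cases h : j = i
    · subst h
      simp
    · simp [h]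
  have (j : Fin n) : IsProbabilityMeasure
      (Function.update (fun j => gaussianReal (θ j) 1) i (gaussianReal a 1) j) := by
    rw [← hup]
    infer_instance
  rw [law, hup, ← pi_update_eq_map, lintegral_map hf hm, lintegral_prod _ (by exact (hf.comp hm).aemeasurable)]
  rfl

/-- Neyman–Pearson comparison when a single coordinate is shifted from `0` to `a`. -/
lemma integral_law_update_le {θ : Fin n → ℝ} {i : Fin n} (hi : θ i = 0) {a : ℝ} (ha : 0 < a)
    (u : ℝ) {f : (Fin n → ℝ) → ℝ} (hf : Measurable f) (h0 : ∀ x, 0 ≤ f x) (h1 : ∀ x, f x ≤ 1) :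
    ∫ x, f x ∂law (Function.update θ i a) ≤ (1 - cdf (gaussianReal 0 1) u) +
      Real.exp (a * u + a ^ 2 / 2) * ∫ x, f x ∂law θ := by
  have hfm : Measurable fun x => ENNReal.ofReal (f x) := hf.ennreal_ofReal
  have hI : 0 ≤ ∫ x, f x ∂law θ := integral_nonneg h0
  have hc : 0 ≤ 1 - cdf (gaussianReal 0 1) u := by linarith [cdf_le_one (gaussianReal 0 1) u]
  have hup : Function.update θ i 0 = θ := by rw [← hi, Function.update_eq_self]
  have key : ∫⁻ x, ENNReal.ofReal (f x) ∂law (Function.update θ i a) ≤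
      ENNReal.ofReal (1 - cdf (gaussianReal 0 1) u) +
        ENNReal.ofReal (Real.exp (a * u + a ^ 2 / 2)) * ∫⁻ x, ENNReal.ofReal (f x) ∂law θ := by
    -- Resampling coordinate i from N(0, 1) leaves `law θ` unchanged, so both sides have outer law
    -- `law θ` and the one-dimensional comparison applies inside.
    conv_rhs => rw [← hup, lintegral_law_update θ i 0 hfm]
    rw [lintegral_law_update θ i a hfm, ← lintegral_const_mul' _ _ ENNReal.ofReal_ne_top]
    refine (lintegral_mono fun x => lintegral_gaussianReal_le ha u
      (hfm.comp (measurable_update x)) fun y => ?_).trans ?_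
    · exact ENNReal.ofReal_le_one.2 (h1 _)
    · rw [lintegral_add_left measurable_const, lintegral_const, measure_univ, mul_one]
      rfl
  rw [← ofReal_integral_eq_lintegral_ofReal (integrable_of_mem_Icc hf h0 h1) (ae_of_all _ h0),
    ← ofReal_integral_eq_lintegral_ofReal (integrable_of_mem_Icc hf h0 h1) (ae_of_all _ h0),
    ← ENNReal.ofReal_mul (Real.exp_nonneg _), ← ENNReal.ofReal_add hc (by positivity)] at key
  exact (ENNReal.ofReal_le_ofReal_iff (by positivity)).1 key

/-- Double counting: (A, i) ↦ (A \ {i}, i) is a bijection, with inverse given by insertion. -/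
lemma sum_powersetCard_succ_erase {α : Type*} [Fintype α] [DecidableEq α] (k : ℕ)
    (g : Finset α → α → ℝ) :
    ∑ A ∈ Finset.powersetCard (k + 1) Finset.univ, ∑ i ∈ A, g (A.erase i) i =
      ∑ B ∈ Finset.powersetCard k Finset.univ, ∑ i ∈ Bᶜ, g B i := by
  rw [Finset.sum_sigma', Finset.sum_sigma']
  refine Finset.sum_bij' (fun p _ => ⟨p.1.erase p.2, p.2⟩) (fun p _ => ⟨insert p.2 p.1, p.2⟩)
    ?_ ?_ ?_ ?_ ?_
  · rintro ⟨A, i⟩ h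
    simp only [Finset.mem_sigma, Finset.mem_powersetCard, Finset.subset_univ, true_and] at h
    simp [Finset.card_erase_of_mem h.2, h.1]
  · rintro ⟨B, i⟩ h
    simp only [Finset.mem_sigma, Finset.mem_powersetCard, Finset.subset_univ, true_and,
      Finset.mem_compl] at h
    simp [Finset.card_insert_of_notMem h.2, h.1]
  · rintro ⟨A, i⟩ h
    simp only [Finset.mem_sigma] at h
    simp [Finset.insert_erase h.2]
  · rintro ⟨B, i⟩ h
    simp only [Finset.mem_sigma, Finset.mem_compl] at h
    simp [Finset.erase_insert h.2]
  · intro p _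
    rfl

/-- The mean vector equal to `a` on `A` and to `0` elsewhere. -/
def signal (a : ℝ) (A : Finset (Fin n)) (i : Fin n) : ℝ := if i ∈ A then a else 0

lemma signal_ne_zero_iff {a : ℝ} (ha : 0 < a) {A : Finset (Fin n)} {i : Fin n} :
    signal a A i ≠ 0 ↔ i ∈ A := by
  simp [signal, ha.ne']

lemma filter_signal_ne_zero {a : ℝ} (ha : 0 < a) (A : Finset (Fin n)) :
    (Finset.univ.filter fun i => signal a A i ≠ 0) = A := by
  ext i
  simp [signal, ha.ne']

lemma signal_mem_betaMin {a : ℝ} (ha : 0 < a) (A : Finset (Fin n)) :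
    signal a A ∈ betaMin n a A.card := by
  refine ⟨by rw [filter_signal_ne_zero ha], fun i hi => ?_⟩
  rw [signal, if_pos ((signal_ne_zero_iff ha).1 hi)]
  exact le_abs_self a

lemma update_signal_erase {a : ℝ} {A : Finset (Fin n)} {i : Fin n} (hi : i ∈ A) :
    Function.update (signal a (A.erase i)) i a = signal a A := by
  ext j
  by_cases h : j = i
  · subst h
    simp [signal, hi]
  · simp [signal, h]

/-- Number of rejections. -/
def rejections (φ : Procedure n) (x : Fin n → ℝ) : ℕ :=
  (Finset.univ.filter fun i => φ x i = true).card

/-- Indicator of the rejection of `i` by the procedure which follows `φ`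
unless `φ` makes more than `r` rejections. -/
noncomputable def cappedReject (φ : Procedure n) (r : ℝ) (i : Fin n) (x : Fin n → ℝ) : ℝ :=
  if φ x i = true ∧ (rejections φ x : ℝ) ≤ r then 1 else 0

lemma measurable_cappedReject (φ : Procedure n) (r : ℝ) (i : Fin n) :
    Measurable (cappedReject φ r i) :=
  φ.measurable_comp fun v => if v i = true ∧
    ((Finset.univ.filter fun i => v i = true).card : ℝ) ≤ r then (1 : ℝ) else 0

lemma cappedReject_nonneg (φ : Procedure n) (r : ℝ) (i : Fin n) (x : Fin n → ℝ) :
    0 ≤ cappedReject φ r i x := by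
  unfold cappedReject
  split_ifs <;> norm_num

lemma cappedReject_le_one (φ : Procedure n) (r : ℝ) (i : Fin n) (x : Fin n → ℝ) :
    cappedReject φ r i x ≤ 1 := by
  unfold cappedReject
  split_ifs <;> norm_num

lemma integrable_cappedReject (φ : Procedure n) (r : ℝ) (i : Fin n) (θ : Fin n → ℝ) :
    Integrable (cappedReject φ r i) (law θ) :=
  integrable_of_mem_Icc (measurable_cappedReject φ r i) (cappedReject_nonneg φ r i)
    (cappedReject_le_one φ r i)

lemma sum_cappedReject_of_le {φ : Procedure n} {r : ℝ} {x : Fin n → ℝ}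
    (h : (rejections φ x : ℝ) ≤ r) (A : Finset (Fin n)) :
    ∑ i ∈ A, cappedReject φ r i x = ((A.filter fun i => φ x i = true).card : ℝ) := by
  rw [Finset.card_filter, Nat.cast_sum]
  refine Finset.sum_congr rfl fun i _ => ?_
  simp [cappedReject, h]

lemma sum_cappedReject_of_lt {φ : Procedure n} {r : ℝ} {x : Fin n → ℝ}
    (h : r < (rejections φ x : ℝ)) (A : Finset (Fin n)) :
    ∑ i ∈ A, cappedReject φ r i x = 0 :=
  Finset.sum_eq_zero fun i _ => by simp [cappedReject, h.not_ge]

lemma sum_cappedReject_le (φ : Procedure n) {r : ℝ} (hr : 0 ≤ r) (x : Fin n → ℝ)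
    (A : Finset (Fin n)) : ∑ i ∈ A, cappedReject φ r i x ≤ r := by
  rcases le_or_gt (rejections φ x : ℝ) r with h | h
  · rw [sum_cappedReject_of_le h]
    refine le_trans ?_ h
    exact_mod_cast Finset.card_le_card (Finset.filter_subset_filter _ (Finset.subset_univ A))
  · rw [sum_cappedReject_of_lt h]
    exact hr

/-- Under the cap, the second factor on the left is exactly the FNP. Over the cap, the capped sum is
0 and at most |A| of more than K|A| rejections are true, so the FDP alone is at least 1 - 1/K. -/
lemma le_FDP_add_FNP (φ : Procedure n) {a K : ℝ} (ha : 0 < a) (hK : 1 < K) {A : Finset (Fin n)}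
    (hA : 0 < A.card) (x : Fin n → ℝ) :
    (1 - K⁻¹) * (1 - (∑ i ∈ A, cappedReject φ (K * A.card) i x) / A.card) ≤
      FDP (signal a A) φ x + FNP (signal a A) φ x := by
  have hA1 : (1 : ℝ) ≤ A.card := by exact_mod_cast hA
  have hK1 : K⁻¹ < 1 := inv_lt_one_of_one_lt₀ hK
  have hK0 : 0 < K⁻¹ := by positivity
  have hFDP := FDP_nonneg (signal a A) φ x
  have hFNP := FNP_nonneg (signal a A) φ x
  rcases le_or_gt (rejections φ x : ℝ) (K * A.card) with h | h
  · rw [sum_cappedReject_of_le h]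
    have hN : FNP (signal a A) φ x =
        1 - ((A.filter fun i => φ x i = true).card : ℝ) / A.card := by
      have hf : (Finset.univ.filter fun i => signal a A i ≠ 0 ∧ φ x i = false) =
          A.filter fun i => ¬ φ x i = true := by
        ext i
        simp [signal_ne_zero_iff ha]
      have hc : ((A.filter fun i => φ x i = true).card : ℝ) +
          (A.filter fun i => ¬ φ x i = true).card = A.card := by
        exact_mod_cast Finset.card_filter_add_card_filter_not (s := A) fun i => φ x i = true
      rw [FNP, hf, filter_signal_ne_zero ha, max_eq_right hA1, eq_sub_iff_add_eq, ← add_div,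
        add_comm, hc, div_self (by positivity)]
    rw [← hN]
    nlinarith
  · rw [sum_cappedReject_of_lt h, zero_div, sub_zero, mul_one]
    have hR : 0 < (rejections φ x : ℝ) := lt_trans (by positivity) h
    have hR1 : (1 : ℝ) ≤ rejections φ x := by
      have : 0 < rejections φ x := by exact_mod_cast hR
      exact_mod_cast this
    have hsplit : (rejections φ x : ℝ) ≤ A.card +
        (Finset.univ.filter fun i => signal a A i = 0 ∧ φ x i = true).card := by
      have : (Finset.univ.filter fun i => φ x i = true) ⊆
          A ∪ Finset.univ.filter fun i => signal a A i = 0 ∧ φ x i = true := by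
        intro i hi
        simp only [Finset.mem_filter, Finset.mem_univ, true_and] at hi
        by_cases hiA : i ∈ A <;> simp [hiA, hi, signal]
      exact_mod_cast (Finset.card_le_card this).trans (Finset.card_union_le _ _)
    have hD : 1 - K⁻¹ ≤ FDP (signal a A) φ x := by
      rw [FDP]
      change _ ≤ _ / max 1 (rejections φ x : ℝ)
      rw [max_eq_right hR1, le_div_iff₀ hR]
      have : (A.card : ℝ) ≤ K⁻¹ * rejections φ x := by
        rw [inv_mul_eq_div, le_div_iff₀ (by positivity)]
        linarith
      linarith
    linarith

lemma le_risk_signal (φ : Procedure n) {a K : ℝ} (ha : 0 < a) (hK : 1 < K) {A : Finset (Fin n)}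
    (hA : 0 < A.card) :
    (1 - K⁻¹) * (1 - (∑ i ∈ A, ∫ x, cappedReject φ (K * A.card) i x ∂law (signal a A)) / A.card) ≤
      risk (signal a A) φ := by
  have hint : Integrable (fun x => (∑ i ∈ A, cappedReject φ (K * A.card) i x) / (A.card : ℝ))
      (law (signal a A)) :=
    (integrable_finsetSum _ fun i _ => integrable_cappedReject φ _ i _).div_const _
  rw [risk_eq_integral]
  refine le_trans (le_of_eq ?_) (integral_mono (((integrable_const 1).sub hint).const_mul (1 - K⁻¹))
    ((integrable_FDP _ φ).add (integrable_FNP _ φ)) fun x => le_FDP_add_FNP φ ha hK hA x)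
  rw [integral_const_mul]
  congr 1
  simp only [Pi.sub_apply]
  rw [integral_sub (integrable_const 1) hint, integral_div,
    integral_finsetSum _ fun i _ => integrable_cappedReject φ _ i _]
  simp

/-- Averaged over the supports `A` of size `s`, a test making at most `r` rejections detects
at most a proportion `1 - Φ(u)` of the signals, up to a remainder. -/
lemma sum_detections_le (φ : Procedure n) {a r : ℝ} (ha : 0 < a) (hr : 0 ≤ r) (u : ℝ) (k : ℕ) :
    ∑ A ∈ Finset.powersetCard (k + 1) Finset.univ,
        ∑ i ∈ A, ∫ x, cappedReject φ r i x ∂law (signal a A) ≤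
      n.choose (k + 1) * ((k + 1) * (1 - cdf (gaussianReal 0 1) u)) +
        Real.exp (a * u + a ^ 2 / 2) * (n.choose k * r) := by
  calc _ ≤ ∑ A ∈ Finset.powersetCard (k + 1) (Finset.univ : Finset (Fin n)), ∑ i ∈ A,
        ((1 - cdf (gaussianReal 0 1) u) + Real.exp (a * u + a ^ 2 / 2) *
          ∫ x, cappedReject φ r i x ∂law (signal a (A.erase i))) := by
        refine Finset.sum_le_sum fun A _ => Finset.sum_le_sum fun i hi => ?_
        rw [← update_signal_erase hi]
        exact integral_law_update_le (by simp [signal]) ha u (measurable_cappedReject φ r i)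
          (cappedReject_nonneg φ r i) (cappedReject_le_one φ r i)
    _ = n.choose (k + 1) * ((k + 1) * (1 - cdf (gaussianReal 0 1) u)) +
        Real.exp (a * u + a ^ 2 / 2) * ∑ B ∈ Finset.powersetCard k (Finset.univ : Finset (Fin n)),
          ∑ i ∈ Bᶜ, ∫ x, cappedReject φ r i x ∂law (signal a B) := by
        simp only [Finset.sum_add_distrib, ← Finset.mul_sum]
        rw [sum_powersetCard_succ_erase k
          fun B i => ∫ x, cappedReject φ r i x ∂law (signal a B)]
        congr 1
        rw [Finset.sum_congr rfl (g := fun _ => ((k : ℝ) + 1) * (1 - cdf (gaussianReal 0 1) u))]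
        · simp
        · intro A hA
          rw [Finset.sum_const, (Finset.mem_powersetCard.1 hA).2]
          simp
    _ ≤ _ := by
        gcongr
        -- For each B, the expected number of capped rejections outside B is at most the cap r.
        refine (Finset.sum_le_card_nsmul _ _ r fun B _ => ?_).trans (by simp)
        rw [← integral_finsetSum _ fun i _ => integrable_cappedReject φ _ i _]
        refine (integral_mono (integrable_finsetSum _ fun i _ => integrable_cappedReject φ _ i _)
          (integrable_const r) fun x => sum_cappedReject_le φ hr x Bᶜ).trans (by simp)

/-- The worst risk dominates the average over supports of size s. The denominator n - s + 1 comes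
from the ratio of the numbers of supports of sizes s - 1 and s. -/
lemma le_worstRisk {s : ℕ} (hs : 0 < s) (hsn : s ≤ n) {a K : ℝ} (ha : 0 < a) (hK : 1 < K) (u : ℝ)
    (φ : Procedure n) :
    (1 - K⁻¹) * (cdf (gaussianReal 0 1) u -
      Real.exp (a * u + a ^ 2 / 2) * K * s / (n - s + 1)) ≤ worstRisk (betaMin n a s) φ := by
  obtain ⟨k, rfl⟩ : ∃ k, s = k + 1 := ⟨s - 1, by omega⟩
  set c := Real.exp (a * u + a ^ 2 / 2)
  set W := worstRisk (betaMin n a (k + 1)) φ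
  set N : ℝ := ((n.choose (k + 1) : ℕ) : ℝ) with hNdef
  have hK1 : 0 < 1 - K⁻¹ := sub_pos.2 (inv_lt_one_of_one_lt₀ hK)
  have hN : 0 < N := Nat.cast_pos.2 (Nat.choose_pos hsn)
  have hk0 : (0 : ℝ) < k + 1 := by positivity
  have hnk : (0 : ℝ) < n - k := by
    have : ((k + 1 : ℕ) : ℝ) ≤ n := by exact_mod_cast hsn
    push_cast at this
    linarith
  have hsum := sum_detections_le φ ha (r := K * (k + 1)) (by positivity) u k
  have hlow : ∀ A ∈ Finset.powersetCard (k + 1) (Finset.univ : Finset (Fin n)),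
      (k + 1) * (1 - W / (1 - K⁻¹)) ≤
        ∑ i ∈ A, ∫ x, cappedReject φ (K * (k + 1)) i x ∂law (signal a A) := by
    intro A hA
    have hcard : A.card = k + 1 := (Finset.mem_powersetCard.1 hA).2
    have h := le_risk_signal φ ha hK (A := A) (by omega)
    have h' := h.trans (risk_le_worstRisk (T := betaMin n a (k + 1))
      (hcard ▸ signal_mem_betaMin ha A) φ)
    rw [hcard] at h'
    push_cast at h'
    -- Read the risk bound backwards: a small worst risk W forces many expected detections on every
    -- support.
    rw [mul_comm, ← le_div_iff₀ hK1, sub_le_comm, le_div_iff₀ hk0, mul_comm] at h'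
    exact h'
  have hlow' := (Finset.card_nsmul_le_sum _ _ _ hlow).trans hsum
  simp only [Finset.card_powersetCard, Finset.card_univ, Fintype.card_fin, nsmul_eq_mul] at hlow'
  have hch : (n.choose k : ℝ) = N * (k + 1) / (n - k) := by
    rw [eq_div_iff hnk.ne']
    have := Nat.choose_succ_right_eq n k
    have h2 : ((n - k : ℕ) : ℝ) = n - k := by
      rw [Nat.cast_sub (by omega)]
    rw [← h2, hNdef]
    exact_mod_cast this.symm
  rw [hch] at hlow'
  have hfac : N * ((k + 1) * (1 - cdf (gaussianReal 0 1) u)) +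
      c * (N * (k + 1) / (n - k) * (K * (k + 1))) =
      N * ((k + 1) * (1 - cdf (gaussianReal 0 1) u + c * K * (k + 1) / (n - k))) := by
    field_simp
  rw [hfac] at hlow'
  have h3 := le_of_mul_le_mul_left (le_of_mul_le_mul_left hlow' hN) hk0
  have h4 : cdf (gaussianReal 0 1) u - c * K * (k + 1) / (n - k) ≤ W / (1 - K⁻¹) := by linarith
  rw [le_div_iff₀ hK1, mul_comm] at h4
  have h5 : ((n : ℝ) - (k + 1 : ℕ) + 1) = n - k := by
    push_cast
    ring
  rw [h5]
  push_cast
  exact h4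

end SparseSeq

namespace SparseSeq

/-! ### Asymptotics -/

/-- The critical signal strength `√(2 log (n / s))`. -/
noncomputable def critical (n s : ℕ) : ℝ := √(2 * Real.log ((n : ℝ) / s))

section Asymptotics

variable {s : ℕ → ℕ}

lemma tendsto_critical (hns : Tendsto (fun n : ℕ => (n : ℝ) / (s n : ℝ)) atTop atTop) :
    Tendsto (fun n => critical n (s n)) atTop atTop :=
  Real.tendsto_sqrt_atTop.comp
    ((Real.tendsto_log_atTop.comp hns).const_mul_atTop (by norm_num : (0 : ℝ) < 2))

lemma exp_critical_sq {n k : ℕ} (h : 1 ≤ (n : ℝ) / k) :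
    Real.exp (critical n k ^ 2 / 2) = (n : ℝ) / k := by
  rw [critical, Real.sq_sqrt (mul_nonneg zero_le_two (Real.log_nonneg h)),
    mul_div_cancel_left₀ _ two_ne_zero, Real.exp_log (by linarith)]

lemma worstRisk_mono {n : ℕ} {T T' : Set (Fin n → ℝ)} (h : T ⊆ T') (φ : Procedure n) :
    worstRisk T φ ≤ worstRisk T' φ :=
  Real.iSup_le (fun θ => risk_le_worstRisk (h θ.2) φ) (worstRisk_nonneg T' φ)

lemma classB_anti {n k : ℕ} {b b' : ℝ} (h : b ≤ b') : classB n k b' ⊆ classB n k b :=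
  fun _ hθ => ⟨hθ.1, fun i hi => (add_le_add_right h _).trans (hθ.2 i hi)⟩

/-- At the critical threshold n·exp(-t²/2) = s, so the false discovery term is a constant multiple
of 1/t. The constant depends only on β, which is why β is fixed here. -/
lemma eventually_worstRisk_threshold_le (hs : Tendsto s atTop atTop)
    (hns : Tendsto (fun n : ℕ => (n : ℝ) / (s n : ℝ)) atTop atTop) (β : ℝ) {ε : ℝ} (hε : 0 < ε) :
    ∀ᶠ n in atTop, worstRisk (classB n (s n) β) (threshold n (critical n (s n))) ≤
      cdf (gaussianReal 0 1) (-β) + ε := by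
  obtain ⟨q, hq⟩ : ∃ q, q = cdf (gaussianReal 0 1) (-β) := ⟨_, rfl⟩
  have hq1 : 0 < 1 - q := by
    rw [hq]
    linarith [cdf_gaussianReal_lt_one (-β)]
  have ht := tendsto_critical hns
  have h1 : Tendsto (fun n => 2 / critical n (s n) / ((1 - q) / 2)) atTop (𝓝 0) := by
    simpa using (ht.const_div_atTop 2).div_const ((1 - q) / 2)
  have h2 : Tendsto (fun n => 1 / ((1 - q) ^ 2 * (s n : ℝ))) atTop (𝓝 0) :=
    ((tendsto_natCast_atTop_atTop.comp hs).const_mul_atTop (by positivity)).const_div_atTop 1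
  have h3 := (h1.add h2).eventually_lt_const (u := ε) (by simpa using hε)
  filter_upwards [h3, ht.eventually_gt_atTop 0, hs.eventually_gt_atTop 0,
    hns.eventually_ge_atTop 1] with n hn ht0 hs0 hx
  refine (worstRisk_threshold_le hs0 ht0 hq).trans ?_
  have hs0' : (0 : ℝ) < s n := by exact_mod_cast hs0
  have hn0 : (0 : ℝ) < n := by
    rw [le_div_iff₀ hs0'] at hx
    linarith
  have hexp : Real.exp (-critical n (s n) ^ 2 / 2) = s n / n := by
    rw [neg_div, Real.exp_neg, exp_critical_sq hx, inv_div]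
  have hfirst : n * (2 * (Real.exp (-critical n (s n) ^ 2 / 2) / critical n (s n))) /
      ((1 - q) / 2 * s n) = 2 / critical n (s n) / ((1 - q) / 2) := by
    rw [hexp]
    field_simp
  rw [hfirst]
  linarith

lemma eventually_le_worstRisk (hsn : ∀ n, s n ≤ n) (hs : Tendsto s atTop atTop)
    (hns : Tendsto (fun n : ℕ => (n : ℝ) / (s n : ℝ)) atTop atTop) (b : ℝ) {ε : ℝ} (hε : 0 < ε) :
    ∀ᶠ n in atTop, ∀ φ : Procedure n,
      cdf (gaussianReal 0 1) (-b) - ε ≤ worstRisk (classB n (s n) b) φ := by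
  -- One small κ governs both free parameters, K = 1/κ and u = -b - κ; continuity of Φ makes the
  -- total loss less than ε.
  have hcont : Continuous fun κ : ℝ => (1 - κ) * (cdf (gaussianReal 0 1) (-b - κ) - κ) :=
    (continuous_const.sub continuous_id).mul
      ((continuous_cdf_gaussianReal.comp (continuous_const.sub continuous_id)).sub continuous_id)
  have hlim : ∀ᶠ κ in 𝓝[>] (0 : ℝ), cdf (gaussianReal 0 1) (-b) - ε <
      (1 - κ) * (cdf (gaussianReal 0 1) (-b - κ) - κ) :=
    (hcont.tendsto 0).mono_left nhdsWithin_le_nhds |>.eventually_const_lt (by simpa using hε)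
  obtain ⟨κ, hκ, hκ1, hκ0⟩ := (hlim.and ((eventually_nhdsWithin_of_eventually_nhds
    (eventually_lt_nhds one_pos)).and self_mem_nhdsWithin)).exists
  have hκ0 : 0 < κ := hκ0
  have ht := tendsto_critical hns
  -- With a = t + b, au + a²/2 = t²/2 - b²/2 - κ(b + t) and exp(t²/2) = n/s. The factor 2 comes from
  -- n ≤ 2(n - s + 1), valid once n/s ≥ 2.
  have hrem : Tendsto (fun n => 2 * κ⁻¹ *
      Real.exp (-b ^ 2 / 2 - κ * (b + critical n (s n)))) atTop (𝓝 0) := by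
    have h : Tendsto (fun n => -b ^ 2 / 2 - κ * (b + critical n (s n))) atTop atBot :=
      tendsto_atBot_add_const_left _ _
        (tendsto_neg_atTop_atBot.comp ((tendsto_atTop_add_const_left _ b ht).const_mul_atTop hκ0))
    simpa using (Real.tendsto_exp_atBot.comp h).const_mul (2 * κ⁻¹)
  filter_upwards [hrem.eventually_lt_const hκ0, ht.eventually_gt_atTop (-b),
    hs.eventually_gt_atTop 0, hns.eventually_ge_atTop 2] with n hn hta hs0 hx φ
  have hs0' : (0 : ℝ) < s n := by exact_mod_cast hs0
  have ha : 0 < critical n (s n) + b := by linarith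
  have h := le_worstRisk hs0 (hsn n) ha (K := κ⁻¹) ((one_lt_inv₀ hκ0).2 hκ1) (-b - κ) φ
  rw [inv_inv] at h
  refine hκ.le.trans (le_trans ?_ h)
  refine mul_le_mul_of_nonneg_left (sub_le_sub_left (le_trans ?_ hn.le) _) (by linarith)
  have hexp : Real.exp ((critical n (s n) + b) * (-b - κ) + (critical n (s n) + b) ^ 2 / 2) =
      n / s n * Real.exp (-b ^ 2 / 2 - κ * (b + critical n (s n))) := by
    rw [← exp_critical_sq (by linarith), ← Real.exp_add]
    congr 1
    ring
  rw [le_div_iff₀ hs0'] at hx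
  rw [hexp, div_le_iff₀ (by linarith)]
  set E := Real.exp (-b ^ 2 / 2 - κ * (b + critical n (s n)))
  have hE : 0 ≤ κ⁻¹ * E := mul_nonneg (by positivity) (Real.exp_nonneg _)
  have h1 : n / s n * E * κ⁻¹ * s n = κ⁻¹ * E * n := by
    field_simp
  rw [h1]
  nlinarith [mul_le_mul_of_nonneg_left hx hE]

lemma tendsto_minimaxRisk_classB (hsn : ∀ n, s n ≤ n) (hs : Tendsto s atTop atTop)
    (hns : Tendsto (fun n : ℕ => (n : ℝ) / (s n : ℝ)) atTop atTop) (b : ℝ) :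
    Tendsto (fun n => minimaxRisk (classB n (s n) b)) atTop
      (𝓝 (cdf (gaussianReal 0 1) (-b))) := by
  refine tendsto_order.2 ⟨fun c hc => ?_, fun c hc => ?_⟩
  · filter_upwards [eventually_le_worstRisk hsn hs hns b (half_pos (sub_pos.2 hc))] with n hn
    exact lt_of_lt_of_le (by linarith) (le_ciInf hn)
  · filter_upwards [eventually_worstRisk_threshold_le hs hns b (half_pos (sub_pos.2 hc))] with n hn
    have := minimaxRisk_le_worstRisk (classB n (s n) b) (threshold n (critical n (s n)))
    linarith

/-- The classes shrink as b grows, so eventually the class for b n lies in that for a fixed B with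
Φ(-B) small. -/
lemma tendsto_worstRisk_threshold (hs : Tendsto s atTop atTop)
    (hns : Tendsto (fun n : ℕ => (n : ℝ) / (s n : ℝ)) atTop atTop) {b : ℕ → ℝ}
    (hb : Tendsto b atTop atTop) :
    Tendsto (fun n => worstRisk (classB n (s n) (b n)) (threshold n (critical n (s n))))
      atTop (𝓝 0) := by
  refine tendsto_order.2 ⟨fun c hc => Eventually.of_forall fun n =>
    hc.trans_le (worstRisk_nonneg _ _), fun c hc => ?_⟩
  obtain ⟨B, hB⟩ := (((tendsto_cdf_atBot (gaussianReal 0 1)).comp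
    tendsto_neg_atTop_atBot).eventually_lt_const (half_pos hc)).exists
  simp only [Function.comp_apply] at hB
  filter_upwards [eventually_worstRisk_threshold_le hs hns B (half_pos hc),
    hb.eventually_ge_atTop B] with n hn hbn
  have := worstRisk_mono (classB_anti (n := n) (k := s n) hbn) (threshold n (critical n (s n)))
  linarith

end Asymptotics

end SparseSeq

theorem mainTheorem12 (s : ℕ → ℕ) (hsn : ∀ n, s n ≤ n)
    (hs : Tendsto s atTop atTop)
    (hns : Tendsto (fun n : ℕ => (n : ℝ) / (s n : ℝ)) atTop atTop) :
    (∀ b : ℕ → ℝ, Tendsto b atTop atTop →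
      ∃ φ : ∀ n, SparseSeq.Procedure n,
        Tendsto (fun n => SparseSeq.worstRisk (SparseSeq.classB n (s n) (b n)) (φ n))
          atTop (𝓝 0)) ∧
    (∀ b : ℝ,
      (∃ L : ℝ, 0 < L ∧
        Tendsto (fun n => SparseSeq.minimaxRisk (SparseSeq.classB n (s n) b)) atTop (𝓝 L)) ∧
      ∀ φ : ∀ n, SparseSeq.Procedure n,
        ¬ Tendsto (fun n => SparseSeq.worstRisk (SparseSeq.classB n (s n) b) (φ n))
          atTop (𝓝 0)) := by
  refine ⟨fun b hb => ⟨fun n => SparseSeq.threshold n (SparseSeq.critical n (s n)),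
    SparseSeq.tendsto_worstRisk_threshold hs hns hb⟩, fun b => ?_⟩
  have hL := SparseSeq.tendsto_minimaxRisk_classB hsn hs hns b
  have hpos := SparseSeq.cdf_gaussianReal_pos (-b)
  refine ⟨⟨_, hpos, hL⟩, fun φ hφ => ?_⟩
  exact hpos.not_ge (le_of_tendsto_of_tendsto' hL hφ fun n =>
    SparseSeq.minimaxRisk_le_worstRisk _ (φ n))
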